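/- Let $X$ and $Y$ be compact Hausdorff spaces, let $C(X)$, $C(Y)$ be the $C^*$-algebras of continuous complex-valued functions on them, let $i\colon C(X)\to C(Y)$ be an injective unital $*$-homomorphism, and let $p=i^*\colon Y\to X$ be its Gelfand dual, i.e. the continuous map with $i(a)=a\circ p$ for all $a\in C(X)$. Regard $C(Y)$ as a $C(X)$-module by $a\cdot f=i(a)f$. Then the following conditions are equivalent. 1. $p$ is a finite-fold covering, i.e. $p$ is a surjective covering map all of whose fibres are finite. 2. There is a $C(X)$-valued inner product $\langle\cdot,\cdot\rangle$ on the module $C(Y)$ which makes it a (complete) Hilbert $C(X)$-module, with norm $\|\langle f,f\rangle\|^{1/2}$, that is finitely generated and projective over $C(X)$. 3. There is a positive unital conditional expectation $E\colon C(Y)\to C(X)$ which is algebraically of index-finite type. Here a positive unital conditional expectation is a linear map $E$ with $E(i(a)b)=aE(b)$, $E(b\,i(a))=E(b)a$, $E(i(a))=a$, $\|E(b)\|\le\|b\|$ and $E(b^*b)\ge 0$ for all $a\in C(X)$, $b\in C(Y)$; it is algebraically of index-finite type if it has a finite quasi-basis, i.e. elements $u_1,\dots,u_n\in C(Y)$ with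 $b=\sum_j u_j\, i\bigl(E(u_j^*b)\bigr)$ for all $b\in C(Y)$. -/

import Mathlib

open scoped ComplexOrder

/-- The Gelfand dual `p = i^* : Y → X` of a unital `*`-homomorphism `i : C(X) → C(Y)`: the map
`χ ↦ χ ∘ i` on characters, where the points of a compact Hausdorff space are identified with the
characters of its algebra of continuous functions through evaluation. -/
noncomputable def gelfandDual {X Y : Type*} [TopologicalSpace X] [CompactSpace X] [T2Space X]
    [TopologicalSpace Y] [CompactSpace Y] [T2Space Y] (i : C(X, ℂ) →⋆ₐ[ℂ] C(Y, ℂ)) : C(Y, X) :=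
  ((WeakDual.CharacterSpace.homeoEval X ℂ).symm : C(_, _)).comp
    ((WeakDual.CharacterSpace.compContinuousMap i).comp
      (WeakDual.CharacterSpace.homeoEval Y ℂ : C(_, _)))

/-- The Gelfand dual `p` of `i` satisfies `i f = f ∘ p`. -/
theorem gelfandDual_apply {X Y : Type*} [TopologicalSpace X] [CompactSpace X] [T2Space X]
    [TopologicalSpace Y] [CompactSpace Y] [T2Space Y] (i : C(X, ℂ) →⋆ₐ[ℂ] C(Y, ℂ))
    (f : C(X, ℂ)) (y : Y) : f (gelfandDual i y) = i f y := by
  have h : WeakDual.CharacterSpace.homeoEval X ℂ (gelfandDual i y) =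
      WeakDual.CharacterSpace.compContinuousMap i (WeakDual.CharacterSpace.homeoEval Y ℂ y) := by
    simp [gelfandDual]
  exact DFunLike.congr_fun h f

/-- A finite-fold covering: a surjective covering map all of whose fibres are finite (the number
of points in a fibre is locally constant; it may differ between components of the base). -/
def IsFiniteFoldCovering {X Y : Type*} [TopologicalSpace X] [TopologicalSpace Y]
    (p : Y → X) : Prop :=
  IsCoveringMap p ∧ Function.Surjective p ∧ ∀ x : X, (p ⁻¹' {x}).Finite

/-- The algebra `C(Y)` regarded as a `C(X)`-module through `i : C(X) → C(Y)`. It carries the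
vector space structure of `C(Y)`, but no norm, so that it can be normed by a `C(X)`-valued inner
product. -/
def InducedModule {X Y : Type*} [TopologicalSpace X] [TopologicalSpace Y]
    (_i : C(X, ℂ) →⋆ₐ[ℂ] C(Y, ℂ)) : Type _ :=
  C(Y, ℂ)

namespace InducedModule

variable {X Y : Type*} [TopologicalSpace X] [TopologicalSpace Y] (i : C(X, ℂ) →⋆ₐ[ℂ] C(Y, ℂ))

noncomputable instance : AddCommGroup (InducedModule i) :=
  inferInstanceAs (AddCommGroup C(Y, ℂ))

noncomputable instance : Module ℂ (InducedModule i) :=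
  inferInstanceAs (Module ℂ C(Y, ℂ))

/-- The action is `a • f = i a * f`. -/
noncomputable instance : Module C(X, ℂ) (InducedModule i) :=
  Module.compHom C(Y, ℂ) (i : C(X, ℂ) →+* C(Y, ℂ))

end InducedModule

/-- `C(Y)` can be equipped with a `C(X)`-valued inner product in such a way that it becomes a
(complete) Hilbert `C(X)`-module which is finitely generated and projective. The norm is part of
the data only formally: it has to be `‖f‖ = ‖⟪f, f⟫‖ ^ (1/2)` by the definition of `CStarModule`,
and completeness refers to this norm. -/
def AdmitsFGProjectiveHilbertModule {X Y : Type*} [TopologicalSpace X] [CompactSpace X]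
    [TopologicalSpace Y] (i : C(X, ℂ) →⋆ₐ[ℂ] C(Y, ℂ)) : Prop :=
  ∃ (_ : Norm (InducedModule i)) (_ : CStarModule C(X, ℂ) (InducedModule i)),
    @CompleteSpace (InducedModule i)
      (CStarModule.normedAddCommGroup C(X, ℂ)).toMetricSpace.toUniformSpace ∧
    Module.Finite C(X, ℂ) (InducedModule i) ∧ Module.Projective C(X, ℂ) (InducedModule i)

/-- A (positive unital) conditional expectation `E : B → A` for a unital inclusion `i : A → B` of
unital C⋆-algebras: a positive linear `A`-bimodule projection of norm one onto `A`.
Since `E 1 = E (i 1) = 1`, the contraction `E` has norm exactly one unless `A` is zero. -/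
structure IsConditionalExpectation {A B : Type*} [CStarAlgebra A] [PartialOrder A]
    [CStarAlgebra B] (i : A →⋆ₐ[ℂ] B) (E : B →ₗ[ℂ] A) : Prop where
  map_incl_mul : ∀ (a : A) (b : B), E (i a * b) = a * E b
  map_mul_incl : ∀ (a : A) (b : B), E (b * i a) = E b * a
  map_incl : ∀ a : A, E (i a) = a
  norm_le : ∀ b : B, ‖E b‖ ≤ ‖b‖
  nonneg : ∀ b : B, 0 ≤ E (star b * b)

/-- `u` is a (finite) quasi-basis for `E`. -/
def IsQuasiBasis {A B : Type*} [CStarAlgebra A] [CStarAlgebra B] (i : A →⋆ₐ[ℂ] B)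
    (E : B →ₗ[ℂ] A) {n : ℕ} (u : Fin n → B) : Prop :=
  ∀ b : B, b = ∑ j, u j * i (E (star (u j) * b))

/-- `E` is algebraically of index-finite type: it has a finite quasi-basis. -/
def IsAlgIndexFinite {A B : Type*} [CStarAlgebra A] [CStarAlgebra B] (i : A →⋆ₐ[ℂ] B)
    (E : B →ₗ[ℂ] A) : Prop :=
  ∃ (n : ℕ) (u : Fin n → B), IsQuasiBasis i E u

/-!
The covering condition is compared with the other two through sums over the fibres of the dual map
`p : Y → X`.

If `p` is a finite-fold covering, then the average over the fibres of `p` is a conditional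
expectation `C(Y) → C(X)`; it preserves continuity because it is, over an evenly covered set, a
finite sum over the sheets. A partition of unity subordinate to open sets on which `p` is injective
yields a quasi-basis (`IsCoveringMap.isAlgIndexFinite_fiberAverage`).

If `E` is a conditional expectation with quasi-basis `u`, then `⟪f, g⟫ = E (star f * g)` is a
`C(X)`-valued inner product. By Cauchy-Schwarz and the expansion in the quasi-basis its norm is
equivalent to the supremum norm (`IsConditionalExpectation.norm_le_sqrt_norm`), so it is definite
and complete; the quasi-basis is also a dual basis of `C(Y)` over `C(X)`.

Finally, let `C(Y)` be finitely generated and projective, with generators `u j` and coordinate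
functionals `φ j`. The open mapping theorem makes the `φ j` bounded, so that `φ j b x` depends only
on `b` on the fibre over `x` (`dualBasis_apply_eq_zero`). Fibres are finite, and the trace of
multiplication by `b` is the sum over the fibre, `∑ j, φ j (b * u j) x = ∑ b y`
(`sum_dualBasis_mul_apply`). Hence fibre sums of continuous functions are continuous. Applied to
bump functions this says that `p` is open and locally injective, thus a local homeomorphism, and a
local homeomorphism between compact Hausdorff spaces is a covering map.
-/

open Topology

/-! ### Continuity of sums over the fibres -/

section FiberSum

variable {X Y : Type*} [TopologicalSpace X] [TopologicalSpace Y]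

theorem IsCoveringMap.continuous_fiberSum {M : Type*} [TopologicalSpace M] [AddCommMonoid M]
    [ContinuousAdd M] {p : Y → X} (hp : IsCoveringMap p)
    (hfin : ∀ x, (p ⁻¹' {x}).Finite) {f : Y → M} (hf : Continuous f) :
    Continuous fun x => ∑ y ∈ (hfin x).toFinset, f y := by
  refine continuous_iff_continuousAt.2 fun x => ?_
  obtain ⟨-, U, hxU, hU, -, H, hH⟩ := hp x
  have : Fintype (p ⁻¹' {x}) := (hfin x).fintype
  refine (hU.isOpenEmbedding_subtypeVal.continuousAt_iff (x := ⟨x, hxU⟩)).1 ?_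
  have hcont : Continuous fun v : U => ∑ a : p ⁻¹' {x}, f (H.symm (v, a)) := by fun_prop
  refine (hcont.congr fun v => ?_).continuousAt
  have hpH (a : p ⁻¹' {x}) : p (H.symm (v, a)) = v := by simp [← hH]
  refine Finset.sum_bij (fun a _ => (H.symm (v, a) : Y)) (fun a _ => by simp [hpH])
    (fun a _ b _ hab => (Prod.ext_iff.1 (H.symm.injective (Subtype.ext hab))).2)
    (fun y hy => ?_) (fun _ _ => rfl)
  have hy : p y = v := by simpa using hy
  refine ⟨(H ⟨y, by simp [hy]⟩).2, Finset.mem_univ _, ?_⟩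
  have : (v, (H ⟨y, by simp [hy]⟩).2) = H ⟨y, by simp [hy]⟩ :=
    Prod.ext (Subtype.ext (by simp [hH, hy])) rfl
  rw [this, H.symm_apply_apply]

variable [T2Space Y] [CompactSpace Y] [T2Space X]

omit [T2Space X] in
/-- If `g` is a bump function at `y` supported in `V`, its fibre sum is positive at `p y`, hence
nearby, and where it is positive the fibre meets `V`. -/
theorem isOpenMap_of_continuous_fiberSum {p : Y → X} (hfin : ∀ x, (p ⁻¹' {x}).Finite)
    (h : ∀ g : C(Y, ℝ), Continuous fun x => ∑ y ∈ (hfin x).toFinset, g y) : IsOpenMap p := by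
  intro V hV
  refine isOpen_iff_mem_nhds.2 ?_
  rintro _ ⟨y, hy, rfl⟩
  obtain ⟨g, hg0, hg1, hg⟩ := exists_continuous_zero_one_of_isClosed hV.isClosed_compl
    (isClosed_singleton (x := y)) (by simpa using hy)
  have hpos : 0 < ∑ z ∈ (hfin (p y)).toFinset, g z := by
    refine Finset.sum_pos' (fun z _ => (hg z).1) ⟨y, by simp, ?_⟩
    simp [hg1 (Set.mem_singleton y)]
  refine Filter.mem_of_superset ((isOpen_lt continuous_const (h g)).mem_nhds hpos) fun x hx => ?_
  have hx : 0 < ∑ z ∈ (hfin x).toFinset, g z := hx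
  obtain ⟨z, hz, hgz⟩ := Finset.exists_ne_zero_of_sum_ne_zero hx.ne'
  refine ⟨z, ?_, by simpa using hz⟩
  by_contra hzV
  exact hgz (hg0 hzV)

omit [T2Space X] in
/-- If `g` is a bump function which is `1` at `y` and `0` on the rest of the fibre of `y`, then its
fibre sum is `1` at `p y`, hence less than `3 / 2` nearby, so no fibre nearby can contain two points
at which `g` exceeds `3 / 4`. -/
theorem isLocallyInjective_of_continuous_fiberSum {p : Y → X} (hp : Continuous p)
    (hfin : ∀ x, (p ⁻¹' {x}).Finite)
    (h : ∀ g : C(Y, ℝ), Continuous fun x => ∑ y ∈ (hfin x).toFinset, g y) :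
    IsLocallyInjective p := by
  classical
  intro y
  obtain ⟨g, hg0, hg1, hg⟩ := exists_continuous_zero_one_of_isClosed
    ((hfin (p y)).subset (Set.sdiff_subset (t := {y}))).isClosed
    (isClosed_singleton (x := y)) (by simp)
  have hgy : g y = 1 := hg1 (Set.mem_singleton y)
  have hsum : ∑ z ∈ (hfin (p y)).toFinset, g z = 1 := by
    rw [Finset.sum_eq_single y (fun z hz hzy => hg0 ⟨by simpa using hz, hzy⟩) (by simp), hgy]
  refine ⟨{z | 3 / 4 < g z} ∩ {z | ∑ w ∈ (hfin (p z)).toFinset, g w < 3 / 2},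
    (isOpen_lt continuous_const g.continuous).inter
      (isOpen_lt ((h g).comp hp) continuous_const), ⟨?_, ?_⟩, ?_⟩
  · simp only [Set.mem_ofPred_eq, hgy]; norm_num
  · simp only [Set.mem_ofPred_eq, hsum]; norm_num
  · rintro a ⟨ha, ha'⟩ b ⟨hb, -⟩ hab
    by_contra hne
    have hle : ∑ w ∈ {a, b}, g w ≤ ∑ w ∈ (hfin (p a)).toFinset, g w := by
      refine Finset.sum_le_sum_of_subset_of_nonneg ?_ fun w _ _ => (hg w).1
      intro w hw
      rcases Finset.mem_insert.1 hw with rfl | hw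
      · simp
      · simp [Finset.mem_singleton.1 hw, hab]
    rw [Finset.sum_pair hne] at hle
    simp only [Set.mem_ofPred_eq] at ha ha' hb
    linarith

theorem isCoveringMap_of_continuous_fiberSum {p : Y → X} (hp : Continuous p)
    (hfin : ∀ x, (p ⁻¹' {x}).Finite)
    (h : ∀ g : C(Y, ℝ), Continuous fun x => ∑ y ∈ (hfin x).toFinset, g y) :
    IsCoveringMap p := by
  refine isLocalHomeomorph_iff_isCoveringMap.1
    (isLocalHomeomorph_iff_isOpenEmbedding_restrict.2 fun y => ?_)
  obtain ⟨U, hU, hyU, hinj⟩ := isLocallyInjective_of_continuous_fiberSum hp hfin h y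
  exact ⟨U, hU.mem_nhds hyU, .of_continuous_injective_isOpenMap
    (hp.comp continuous_subtype_val) (Set.injOn_iff_injective.1 hinj)
    ((isOpenMap_of_continuous_fiberSum hfin h).comp hU.isOpenMap_subtype_val)⟩

end FiberSum

/-! ### Averaging over the fibres of a covering -/

section CoveringToExpectation

variable {X Y : Type*} [TopologicalSpace X] [CompactSpace X]
  [TopologicalSpace Y] [CompactSpace Y]

/-- A finite partition of unity each member of which is nonzero in at most one point of each
fibre. -/
theorem IsLocallyInjective.exists_finite_partition {X Y : Type*} [TopologicalSpace Y]
    [CompactSpace Y] [T2Space Y] {p : Y → X} (hp : IsLocallyInjective p) :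
    ∃ (n : ℕ) (ρ : Fin n → C(Y, ℝ)), (∀ j y, 0 ≤ ρ j y) ∧ (∀ y, ∑ j, ρ j y = 1) ∧
      ∀ j y z, p y = p z → ρ j y ≠ 0 → ρ j z ≠ 0 → y = z := by
  choose U hU hyU hinj using hp
  obtain ⟨t, ht⟩ := isCompact_univ.elim_finite_subcover U hU
    fun y _ => Set.mem_iUnion.2 ⟨y, hyU y⟩
  obtain ⟨ρ, hρ⟩ := PartitionOfUnity.exists_isSubordinate isClosed_univ
    (fun k : Fin t.card => U (t.equivFin.symm k)) (fun _ => hU _) fun y _ => by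
      obtain ⟨z, hz, hyz⟩ := Set.mem_iUnion₂.1 (ht (Set.mem_univ y))
      exact Set.mem_iUnion.2 ⟨t.equivFin ⟨z, hz⟩, by simpa using hyz⟩
  refine ⟨t.card, ρ, fun j y => ρ.nonneg j y, fun y => ?_, fun j y z hyz hy hz => ?_⟩
  · rw [← ρ.sum_eq_one (Set.mem_univ y), finsum_eq_sum_of_fintype]
  · exact hinj _ (hρ j (subset_tsupport _ hy)) (hρ j (subset_tsupport _ hz)) hyz

/-- The averaging map `f ↦ (x ↦ |p⁻¹(x)|⁻¹ ∑ f y)`, the sum being over the points `y` of the fibre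
over `x`. -/
noncomputable def IsCoveringMap.fiberAverage {p : Y → X} (hp : IsCoveringMap p)
    (hfin : ∀ x, (p ⁻¹' {x}).Finite) (hsurj : Function.Surjective p) :
    C(Y, ℂ) →ₗ[ℂ] C(X, ℂ) where
  toFun f :=
    { toFun := fun x => ((hfin x).toFinset.card : ℂ)⁻¹ * ∑ y ∈ (hfin x).toFinset, f y
      continuous_toFun := by
        refine .mul (.inv₀ ?_ fun x => ?_) (hp.continuous_fiberSum hfin f.continuous)
        · simpa using hp.continuous_fiberSum hfin (continuous_const (y := (1 : ℂ)))
        · obtain ⟨y, hy⟩ := hsurj x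
          exact Nat.cast_ne_zero.2 (Finset.card_ne_zero_of_mem (a := y) (by simpa using hy)) }
  map_add' f g := by ext; simp [Finset.sum_add_distrib, mul_add]
  map_smul' c f := by ext; simp [← Finset.mul_sum, mul_left_comm]

variable {i : C(X, ℂ) →⋆ₐ[ℂ] C(Y, ℂ)} {p : Y → X}

theorem IsCoveringMap.isConditionalExpectation_fiberAverage (hi : ∀ a y, i a y = a (p y))
    (hp : IsCoveringMap p) (hfin : ∀ x, (p ⁻¹' {x}).Finite) (hsurj : Function.Surjective p) :
    IsConditionalExpectation i (hp.fiberAverage hfin hsurj) := by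
  have happ (f : C(Y, ℂ)) (x : X) : hp.fiberAverage hfin hsurj f x =
      ((hfin x).toFinset.card : ℂ)⁻¹ * ∑ y ∈ (hfin x).toFinset, f y := rfl
  have hcard (x : X) : ((hfin x).toFinset.card : ℂ) ≠ 0 := by
    obtain ⟨y, hy⟩ := hsurj x
    exact Nat.cast_ne_zero.2 (Finset.card_ne_zero_of_mem (a := y) (by simpa using hy))
  have hmul (a : C(X, ℂ)) (b : C(Y, ℂ)) : hp.fiberAverage hfin hsurj (i a * b) =
      a * hp.fiberAverage hfin hsurj b := by
    ext x
    rw [ContinuousMap.mul_apply, happ, happ, mul_left_comm, Finset.mul_sum (f := b)]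
    refine congrArg (((hfin x).toFinset.card : ℂ)⁻¹ * ·) (Finset.sum_congr rfl fun y hy => ?_)
    have hy : p y = x := by simpa using hy
    rw [ContinuousMap.mul_apply, hi, hy]
  refine ⟨hmul, fun a b => by rw [mul_comm, hmul, mul_comm], fun a => ?_, fun b => ?_, fun b => ?_⟩
  · have h1 : hp.fiberAverage hfin hsurj 1 = 1 := by
      ext x
      simp [happ, hcard]
    rw [← mul_one (i a), hmul, h1, mul_one]
  · refine (ContinuousMap.norm_le _ (norm_nonneg _)).2 fun x => ?_
    rw [happ, norm_mul, norm_inv, Complex.norm_natCast]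
    have hpos : (0 : ℝ) < (hfin x).toFinset.card :=
      Nat.cast_pos.2 (Nat.pos_of_ne_zero (Nat.cast_ne_zero.1 (hcard x)))
    rw [inv_mul_le_iff₀ hpos, ← nsmul_eq_mul, ← Finset.sum_const]
    exact norm_sum_le_of_le _ fun y _ => b.norm_coe_le_norm y
  · rw [ContinuousMap.le_def]
    intro x
    rw [happ]
    refine mul_nonneg (inv_nonneg.2 (Nat.cast_nonneg _)) (Finset.sum_nonneg fun y _ => ?_)
    exact star_mul_self_nonneg (b y)

/-- For a partition of unity `ρ` each member of which is nonzero in at most one point of each fibre,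
the functions `√(N * ρ j)`, with `N y` the number of points in the fibre of `y`, form a
quasi-basis. -/
theorem IsCoveringMap.isAlgIndexFinite_fiberAverage [T2Space Y] (hi : ∀ a y, i a y = a (p y))
    (hp : IsCoveringMap p) (hfin : ∀ x, (p ⁻¹' {x}).Finite) (hsurj : Function.Surjective p) :
    IsAlgIndexFinite i (hp.fiberAverage hfin hsurj) := by
  have happ (f : C(Y, ℂ)) (x : X) : hp.fiberAverage hfin hsurj f x =
      ((hfin x).toFinset.card : ℂ)⁻¹ * ∑ y ∈ (hfin x).toFinset, f y := rfl
  obtain ⟨n, ρ, hρ0, hρ1, hρ⟩ := hp.isLocalHomeomorph.isLocallyInjective.exists_finite_partition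
  have hN : Continuous fun y => ((hfin (p y)).toFinset.card : ℝ) := by
    simpa [Function.comp_def] using
      (hp.continuous_fiberSum hfin (continuous_const (y := (1 : ℝ)))).comp hp.continuous
  let v (j : Fin n) (y : Y) : ℝ := √((hfin (p y)).toFinset.card * ρ j y)
  have hv0 (j : Fin n) (y : Y) (h : ρ j y = 0) : v j y = 0 := by simp [v, h]
  have hvv (j : Fin n) (y : Y) : v j y * v j y = (hfin (p y)).toFinset.card * ρ j y :=
    Real.mul_self_sqrt (mul_nonneg (Nat.cast_nonneg _) (hρ0 j y))
  let u (j : Fin n) : C(Y, ℂ) :=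
    ⟨fun y => (v j y : ℂ), Complex.continuous_ofReal.comp (hN.mul (ρ j).continuous).sqrt⟩
  refine ⟨n, u, fun b => ?_⟩
  ext y
  have hy : y ∈ (hfin (p y)).toFinset := by simp
  have hc : ((hfin (p y)).toFinset.card : ℂ) ≠ 0 :=
    Nat.cast_ne_zero.2 (Finset.card_ne_zero_of_mem hy)
  have key (j : Fin n) : (u j * i (hp.fiberAverage hfin hsurj (star (u j) * b))) y =
      ρ j y * b y := by
    -- `u j` is nonzero in at most one point of the fibre of `y`, so only the term of `y` survives.
    have hsum : u j y * ∑ z ∈ (hfin (p y)).toFinset, (star (u j) * b) z =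
        u j y * (u j y * b y) := by
      rw [Finset.mul_sum, Finset.sum_eq_single y (fun z hz hzy => ?_) (fun h => absurd hy h)]
      · simp [u]
      · by_cases h : ρ j y = 0
        · simp [u, hv0 j y h]
        · have h' : ρ j z = 0 := by
            by_contra h'
            exact hzy (hρ j z y (by simpa using hz) h' h)
          simp [u, hv0 j z h']
    rw [ContinuousMap.mul_apply, hi, happ, mul_left_comm, hsum, ← mul_assoc (u j y)]
    change _ * (((v j y : ℂ) * (v j y : ℂ)) * b y) = _
    rw [← Complex.ofReal_mul, hvv]
    push_cast
    field_simp
  rw [ContinuousMap.sum_apply, Finset.sum_congr rfl fun j _ => key j, ← Finset.sum_mul,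
    ← Complex.ofReal_sum, hρ1, Complex.ofReal_one, one_mul]

end CoveringToExpectation

/-! ### The Hilbert module of a conditional expectation -/

section ExpectationToHilbertModule

theorem completeSpace_of_norm_bounds {V W : Type*} [NormedAddCommGroup V] [NormedAddCommGroup W]
    [CompleteSpace W] (e : V ≃+ W) {K C : ℝ} (hK : ∀ v, ‖v‖ ≤ K * ‖e v‖)
    (hC : ∀ v, ‖e v‖ ≤ C * ‖v‖) : CompleteSpace V :=
  (((AddMonoidHomClass.antilipschitz_of_bound (K := K.toNNReal) e fun v =>
    (hK v).trans (by gcongr; exact Real.le_coe_toNNReal K)).isUniformInducing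
    (AddMonoidHomClass.uniformContinuous_of_bound e C hC)).completeSpace_congr e.surjective).2
    inferInstance

variable {X Y : Type*} [TopologicalSpace X] [CompactSpace X]
  [TopologicalSpace Y] [CompactSpace Y]
  {i : C(X, ℂ) →⋆ₐ[ℂ] C(Y, ℂ)} {E : C(Y, ℂ) →ₗ[ℂ] C(X, ℂ)}

namespace IsConditionalExpectation

theorem map_star (hE : IsConditionalExpectation i E) (b : C(Y, ℂ)) :
    E (star b) = star (E b) := by
  have hpos (c : C(Y, ℂ)) (hc : 0 ≤ c) : 0 ≤ E c := by
    obtain ⟨d, rfl⟩ := CStarAlgebra.nonneg_iff_eq_star_mul_self.1 hc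
    exact hE.nonneg d
  exact StarHomClass.map_star (PositiveLinearMap.mk₀ E hpos) b

/-- The positive semidefinite sesquilinear form `(f, g) ↦ E (star f * g) x` on `C(Y)`, for a fixed
point `x`. -/
@[reducible]
noncomputable def formAt (hE : IsConditionalExpectation i E) (x : X) :
    PreInnerProductSpace.Core ℂ C(Y, ℂ) where
  inner f g := E (star f * g) x
  conj_inner_symm f g := by
    change star (E (star g * f) x) = _
    rw [← ContinuousMap.star_apply, ← hE.map_star, star_mul, star_star]
  re_inner_nonneg f := (Complex.nonneg_iff.1 (ContinuousMap.le_def.1 (hE.nonneg f) x)).1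
  add_left f g h := by simp [add_mul]
  smul_left f g c := by simp

/-- The Cauchy-Schwarz inequality, proved pointwise on `X`. It does not assume that the inner
product `E (star f * g)` is definite, so it can be used to show that it is. -/
theorem norm_sq_map_star_mul_le (hE : IsConditionalExpectation i E) (f g : C(Y, ℂ)) :
    ‖E (star f * g)‖ ^ 2 ≤ ‖E (star f * f)‖ * ‖E (star g * g)‖ := by
  have hx (x : X) : ‖E (star f * g) x‖ ^ 2 ≤ ‖E (star f * f)‖ * ‖E (star g * g)‖ := by
    have h := @InnerProductSpace.Core.inner_mul_inner_self_le ℂ C(Y, ℂ) _ _ _ (hE.formAt x) f g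
    have hsymm : ‖E (star g * f) x‖ = ‖E (star f * g) x‖ := by
      rw [← norm_star (E (star f * g) x), ← ContinuousMap.star_apply, ← hE.map_star, star_mul,
        star_star]
    calc ‖E (star f * g) x‖ ^ 2 = ‖E (star f * g) x‖ * ‖E (star g * f) x‖ := by rw [hsymm, sq]
      _ ≤ (E (star f * f) x).re * (E (star g * g) x).re := h
      _ ≤ ‖E (star f * f)‖ * ‖E (star g * g)‖ := by
        refine mul_le_mul ?_ ?_ ?_ (norm_nonneg _)
        · exact (Complex.re_le_norm _).trans (ContinuousMap.norm_coe_le_norm _ x)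
        · exact (Complex.re_le_norm _).trans (ContinuousMap.norm_coe_le_norm _ x)
        · exact (hE.formAt x).re_inner_nonneg g
  rw [← Real.le_sqrt (norm_nonneg _) (by positivity)]
  exact (ContinuousMap.norm_le _ (Real.sqrt_nonneg _)).2 fun x => Real.le_sqrt_of_sq_le (hx x)

/-- A quasi-basis bounds the supremum norm by the Hilbert module norm: apply Cauchy-Schwarz to each
coefficient in the expansion of `f`. -/
theorem norm_le_sqrt_norm (hE : IsConditionalExpectation i E) {n : ℕ} {u : Fin n → C(Y, ℂ)}
    (hu : IsQuasiBasis i E u) (f : C(Y, ℂ)) :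
    ‖f‖ ≤ (∑ j, ‖u j‖ * √‖E (star (u j) * u j)‖) * √‖E (star f * f)‖ := by
  rw [Finset.sum_mul]
  conv_lhs => rw [hu f]
  refine norm_sum_le_of_le _ fun j _ => (norm_mul_le _ _).trans ?_
  rw [mul_assoc]
  gcongr
  rw [← Real.sqrt_mul (norm_nonneg _)]
  exact (NonUnitalStarAlgHom.norm_apply_le i _).trans
    (Real.le_sqrt_of_sq_le (hE.norm_sq_map_star_mul_le _ _))

theorem sqrt_norm_le (hE : IsConditionalExpectation i E) (f : C(Y, ℂ)) :
    √‖E (star f * f)‖ ≤ ‖f‖ := by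
  refine Real.sqrt_le_iff.2 ⟨norm_nonneg _, ?_⟩
  rw [sq, ← CStarRing.norm_star_mul_self]
  exact hE.norm_le _

/-- The Hilbert module structure `⟪f, g⟫ = E (star f * g)` on `C(Y)`, with the norm
`‖⟪f, f⟫‖ ^ (1/2)`. The quasi-basis serves only to make the inner product definite. -/
@[reducible]
noncomputable def cstarModule (hE : IsConditionalExpectation i E) {n : ℕ} {u : Fin n → C(Y, ℂ)}
    (hu : IsQuasiBasis i E u) :
    letI : Norm (InducedModule i) := ⟨fun f : C(Y, ℂ) => √‖E (star f * f)‖⟩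
    CStarModule C(X, ℂ) (InducedModule i) :=
  letI : Norm (InducedModule i) := ⟨fun f : C(Y, ℂ) => √‖E (star f * f)‖⟩
  { inner := fun f g : C(Y, ℂ) => E (star f * g)
    inner_add_right := fun {f g h : C(Y, ℂ)} =>
      show E (star f * (g + h)) = _ by rw [mul_add, map_add]
    inner_self_nonneg := fun {f : C(Y, ℂ)} => hE.nonneg f
    inner_self := fun {f : C(Y, ℂ)} => by
      change E (star f * f) = 0 ↔ f = 0
      refine ⟨fun h => norm_le_zero_iff.1 ?_, fun h => by simp [h]⟩
      simpa [h] using hE.norm_le_sqrt_norm hu f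
    inner_op_smul_right := fun {a} {f g : C(Y, ℂ)} => by
      change E (star f * (i a * g)) = a * E (star f * g)
      rw [mul_left_comm, hE.map_incl_mul]
    inner_smul_right_complex := fun {c} {f g : C(Y, ℂ)} =>
      show E (star f * (c • g)) = _ by rw [mul_smul_comm, map_smul]
    star_inner := fun f g : C(Y, ℂ) =>
      show star (E (star f * g)) = E (star g * f) by rw [← hE.map_star, star_mul, star_star]
    norm_eq_sqrt_norm_inner_self := fun _ => rfl }

/-- The two norms on `C(Y)` are equivalent, which gives completeness; the maps
`b ↦ (E (star (u j) * b))ⱼ` and `a ↦ ∑ j, a j • u j` exhibit `C(Y)` as a direct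
summand of a free module of finite rank. -/
theorem admitsFGProjectiveHilbertModule (hE : IsConditionalExpectation i E)
    (hfin : IsAlgIndexFinite i E) : AdmitsFGProjectiveHilbertModule i := by
  obtain ⟨n, u, hu⟩ := hfin
  let s : (Fin n → C(X, ℂ)) →ₗ[C(X, ℂ)] InducedModule i :=
    Fintype.linearCombination C(X, ℂ) (M := InducedModule i) u
  let r : InducedModule i →ₗ[C(X, ℂ)] (Fin n → C(X, ℂ)) :=
    { toFun := fun b : C(Y, ℂ) => fun j => E (star (u j) * b)
      map_add' := fun b c : C(Y, ℂ) => funext fun j =>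
        show E (star (u j) * (b + c)) = _ by rw [mul_add, map_add]; rfl
      map_smul' := fun a => fun b : C(Y, ℂ) => funext fun j =>
        show E (star (u j) * (i a * b)) = _ by rw [mul_left_comm, hE.map_incl_mul]; rfl }
  have hsr : s ∘ₗ r = LinearMap.id := by
    refine LinearMap.ext fun b : C(Y, ℂ) => ?_
    refine Eq.trans ?_ (hu b).symm
    change ∑ j, i (E (star (u j) * b)) * u j = _
    exact Finset.sum_congr rfl fun j _ => mul_comm _ _
  let _ : Norm (InducedModule i) := ⟨fun f : C(Y, ℂ) => √‖E (star f * f)‖⟩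
  let _ : CStarModule C(X, ℂ) (InducedModule i) := hE.cstarModule hu
  refine ⟨_, hE.cstarModule hu, ?_, .of_surjective s (LinearMap.surjective_of_comp_eq_id r s hsr),
    .of_split r s hsr⟩
  let _ := CStarModule.normedAddCommGroup C(X, ℂ) (E := InducedModule i)
  let e : InducedModule i ≃+ C(Y, ℂ) := AddEquiv.refl C(Y, ℂ)
  exact completeSpace_of_norm_bounds e (K := 1)
    (fun f => (hE.sqrt_norm_le f).trans (one_mul _).ge) (hE.norm_le_sqrt_norm hu)

end IsConditionalExpectation

end ExpectationToHilbertModule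

/-! ### Dual bases of `C(Y)` over `C(X)` -/

section DualBasis

variable {X Y : Type*} [TopologicalSpace X] [CompactSpace X] [T2Space X]
  [TopologicalSpace Y] [CompactSpace Y] [T2Space Y] {p : C(Y, X)} {n : ℕ}
  {φ : Fin n → C(Y, ℂ) →+ C(X, ℂ)} {u : Fin n → C(Y, ℂ)}

theorem exists_eq_one_and_eqOn_zero {s : Set Y} (hs : s.Finite) (y : Y) :
    ∃ e : C(Y, ℂ), e y = 1 ∧ ∀ z ∈ s, z ≠ y → e z = 0 := by
  obtain ⟨g, hg0, hg1, -⟩ := exists_continuous_zero_one_of_isClosed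
    (hs.subset (Set.sdiff_subset (t := {y}))).isClosed (isClosed_singleton (x := y)) (by simp)
  refine ⟨⟨fun z => (g z : ℂ), by fun_prop⟩, ?_, fun z hz hzy => ?_⟩
  · simp [hg1 (Set.mem_singleton y)]
  · simp [hg0 (show z ∈ s \ {y} from ⟨hz, hzy⟩)]

omit [CompactSpace X] [T2Space X] in
/-- The vectors `(u j y)ⱼ ∈ ℂⁿ`, for `y` in one fibre, are linearly independent, so a fibre has at
most `n` points. -/
theorem finite_fiber_of_dualBasis
    (hu : ∀ b, b = ∑ j, (φ j b).comp p * u j) (x : X) : (p ⁻¹' {x}).Finite := by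
  have hli : LinearIndependent ℂ fun (y : p ⁻¹' {x}) (j : Fin n) => u j y := by
    classical
    rw [linearIndependent_iff']
    intro s c hc y hy
    obtain ⟨e, hey, he⟩ :=
      exists_eq_one_and_eqOn_zero (s.finite_toSet.image (Subtype.val : _ → Y)) (y : Y)
    calc c y = ∑ z ∈ s, c z * e z := by
          rw [Finset.sum_eq_single y (fun z hz hzy => ?_) (fun h => absurd hy h), hey, mul_one]
          rw [he z ⟨z, hz, rfl⟩ (Subtype.coe_injective.ne hzy), mul_zero]
      _ = ∑ z ∈ s, c z * ∑ j, φ j e x * u j z := by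
          refine Finset.sum_congr rfl fun z _ => ?_
          have hz : p z = x := z.2
          conv_lhs => rw [hu e]
          simp [ContinuousMap.sum_apply, hz]
      _ = ∑ j, φ j e x * (∑ z ∈ s, c z • fun j => u j (z : Y)) j := by
          simp only [Finset.mul_sum, Finset.sum_apply, Pi.smul_apply, smul_eq_mul]
          rw [Finset.sum_comm]
          exact Finset.sum_congr rfl fun _ _ => Finset.sum_congr rfl fun _ _ => by ring
      _ = 0 := by rw [hc]; simp
  have := hli.finite
  exact Set.toFinite _

omit [T2Space X] [T2Space Y] in
/-- Coordinate functionals are automatically bounded for the supremum norms. By the open mapping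
theorem `b = ∑ k, a k * u k` with `a` bounded in terms of `b`, and then
`φ j b = ∑ k, a k * φ j (u k)`. -/
theorem exists_norm_dualBasis_le
    (hφ : ∀ j a b, φ j (a.comp p * b) = a * φ j b)
    (hu : ∀ b, b = ∑ j, (φ j b).comp p * u j) (j : Fin n) :
    ∃ C : ℝ, 0 < C ∧ ∀ b, ‖φ j b‖ ≤ C * ‖b‖ := by
  let T : (Fin n → C(X, ℂ)) →L[ℂ] C(Y, ℂ) :=
    { toFun := fun a => ∑ k, (a k).comp p * u k
      map_add' := fun a b => by
        rw [← Finset.sum_add_distrib]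
        exact Finset.sum_congr rfl fun k _ => by ext; simp [add_mul]
      map_smul' := fun c a => by
        rw [RingHom.id_apply, Finset.smul_sum]
        exact Finset.sum_congr rfl fun k _ => by ext; simp
      cont := by
        refine continuous_finsetSum _ fun k _ => ?_
        exact ((ContinuousMap.continuous_precomp p).comp (continuous_apply k)).mul
          continuous_const }
  obtain ⟨C, hC, h⟩ := T.exists_preimage_norm_le fun b => ⟨fun k => φ k b, (hu b).symm⟩
  refine ⟨C * (∑ k, ‖φ j (u k)‖ + 1), by positivity, fun b => ?_⟩
  obtain ⟨a, rfl, ha⟩ := h b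
  calc ‖φ j (T a)‖ = ‖∑ k, a k * φ j (u k)‖ := by
        change ‖φ j (∑ k, (a k).comp p * u k)‖ = _
        simp only [map_sum, hφ]
    _ ≤ ∑ k, ‖a‖ * ‖φ j (u k)‖ := norm_sum_le_of_le _ fun k _ =>
        (norm_mul_le _ _).trans (by gcongr; exact norm_le_pi_norm a k)
    _ ≤ ‖a‖ * (∑ k, ‖φ j (u k)‖ + 1) := by
        rw [← Finset.mul_sum]; gcongr; linarith
    _ ≤ C * ‖T a‖ * (∑ k, ‖φ j (u k)‖ + 1) := by gcongr
    _ = _ := by ring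

omit [T2Space Y] in
/-- The value of `φ j b` at `x` depends only on the restriction of `b` to the fibre over `x`: a
function vanishing on the fibre is a uniform limit of functions `a.comp p * b` with `a x = 0`. -/
theorem dualBasis_apply_eq_zero
    (hφ : ∀ j a b, φ j (a.comp p * b) = a * φ j b)
    (hu : ∀ b, b = ∑ j, (φ j b).comp p * u j) (j : Fin n) {x : X} {b : C(Y, ℂ)}
    (hb : ∀ y, p y = x → b y = 0) : φ j b x = 0 := by
  obtain ⟨C, hC, hbd⟩ := exists_norm_dualBasis_le hφ hu j
  refine norm_le_zero_iff.1 (le_of_forall_pos_le_add fun ε hε => ?_)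
  have hK : IsClosed (p '' {y | ε / C ≤ ‖b y‖}) :=
    ((isClosed_le continuous_const (by fun_prop)).isCompact.image p.continuous).isClosed
  obtain ⟨g, hg0, hg1, hg⟩ := exists_continuous_zero_one_of_isClosed
    (isClosed_singleton (x := x)) hK <| by
      rw [Set.disjoint_singleton_left]
      rintro ⟨y, hy, hyx⟩
      have hy : ε / C ≤ ‖b y‖ := hy
      rw [hb y hyx, norm_zero] at hy
      exact absurd hy (not_le.2 (by positivity))
  -- `a` vanishes at `x` and equals `1` below every point where `b` is not small.
  let a : C(X, ℂ) := ⟨fun x => (g x : ℂ), by fun_prop⟩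
  have hax : a x = 0 := by simp [a, hg0 (Set.mem_singleton x)]
  have hsmall : ‖b - a.comp p * b‖ ≤ ε / C := by
    refine (ContinuousMap.norm_le _ (by positivity)).2 fun y => ?_
    have hy : (b - a.comp p * b) y = ((1 - g (p y) : ℝ) : ℂ) * b y := by
      simp [a]; ring
    rw [hy, norm_mul, Complex.norm_real, Real.norm_of_nonneg (by linarith [(hg (p y)).2])]
    by_cases h : ε / C ≤ ‖b y‖
    · rw [hg1 ⟨y, h, rfl⟩]; simp; positivity
    · calc (1 - g (p y)) * ‖b y‖ ≤ 1 * ‖b y‖ := by gcongr; linarith [(hg (p y)).1]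
        _ ≤ ε / C := by linarith
  calc ‖φ j b x‖ = ‖φ j (b - a.comp p * b) x‖ := by simp [map_sub, hφ, hax]
    _ ≤ ‖φ j (b - a.comp p * b)‖ := ContinuousMap.norm_coe_le_norm _ _
    _ ≤ C * (ε / C) := (hbd _).trans (by gcongr)
    _ = 0 + ε := by field_simp; ring

/-- The trace formula. The left-hand side is the trace of multiplication by `b` on the projective
module `C(Y)`; its value at `x` is the trace of multiplication by `b` on the functions on the fibre
over `x`. -/
theorem sum_dualBasis_mul_apply
    (hφ : ∀ j a b, φ j (a.comp p * b) = a * φ j b)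
    (hu : ∀ b, b = ∑ j, (φ j b).comp p * u j) (hfin : ∀ x, (p ⁻¹' {x}).Finite)
    (b : C(Y, ℂ)) (x : X) : ∑ j, φ j (b * u j) x = ∑ y ∈ (hfin x).toFinset, b y := by
  classical
  choose e he he' using fun y => exists_eq_one_and_eqOn_zero (hfin x) y
  -- On the fibre, `b * u j` agrees with a combination of the functions `e y`, which are the
  -- indicators of the points `y` of the fibre.
  have key (j : Fin n) : φ j (b * u j) x =
      ∑ y ∈ (hfin x).toFinset, b y * u j y * φ j (e y) x := by
    have h0 := dualBasis_apply_eq_zero hφ hu j (x := x)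
      (b := b * u j - ∑ y ∈ (hfin x).toFinset,
        (ContinuousMap.const X (b y * u j y)).comp p * e y) fun z hz => by
      have hz' : z ∈ (hfin x).toFinset := by simpa using hz
      rw [ContinuousMap.sub_apply, ContinuousMap.sum_apply,
        Finset.sum_eq_single z (fun y _ hyz => ?_) (fun h => absurd hz' h)]
      · simp [he]
      · simp [he' y z hz hyz.symm]
    rw [map_sub, map_sum, ContinuousMap.sub_apply, sub_eq_zero] at h0
    rw [h0, ContinuousMap.sum_apply]
    exact Finset.sum_congr rfl fun y _ => by rw [hφ]; simp
  simp only [key]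
  rw [Finset.sum_comm]
  refine Finset.sum_congr rfl fun y hy => ?_
  have hy : p y = x := by simpa using hy
  calc ∑ j, b y * u j y * φ j (e y) x = b y * (∑ j, (φ j (e y)).comp p * u j) y := by
        rw [ContinuousMap.sum_apply, Finset.mul_sum]
        exact Finset.sum_congr rfl fun j _ => by simp [hy]; ring
    _ = b y := by rw [← hu, he, mul_one]

theorem isCoveringMap_of_dualBasis
    (hφ : ∀ j a b, φ j (a.comp p * b) = a * φ j b)
    (hu : ∀ b, b = ∑ j, (φ j b).comp p * u j) : IsCoveringMap p := by
  have hfin := finite_fiber_of_dualBasis hu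
  refine isCoveringMap_of_continuous_fiberSum p.continuous hfin fun g => ?_
  let b : C(Y, ℂ) := ⟨fun y => (g y : ℂ), by fun_prop⟩
  have hc : Continuous fun x => (∑ j, φ j (b * u j) x).re := by fun_prop
  refine hc.congr fun x => ?_
  rw [sum_dualBasis_mul_apply hφ hu hfin]
  simp [b]

end DualBasis

theorem surjective_of_comp_injective {X Y : Type*} [TopologicalSpace X] [CompactSpace X] [T2Space X]
    [TopologicalSpace Y] [CompactSpace Y] {p : C(Y, X)}
    (h : Function.Injective fun a : C(X, ℂ) => a.comp p) : Function.Surjective p := by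
  by_contra hp
  obtain ⟨x, hx⟩ := not_forall.1 hp
  obtain ⟨g, hg0, hg1, -⟩ := exists_continuous_zero_one_of_isClosed
    (isCompact_range p.continuous).isClosed (isClosed_singleton (x := x)) (by simpa using hx)
  let a : C(X, ℂ) := ⟨fun x => (g x : ℂ), by fun_prop⟩
  have ha : a = 0 := h <| by
    ext y
    simp [a, hg0 (Set.mem_range_self y)]
  have := DFunLike.congr_fun ha x
  simp [a, hg1 (Set.mem_singleton x)] at this

/-! ### The equivalence -/

/-- A finitely generated projective module has a finite dual basis, and a finite dual basis of
`C(Y)` over `C(X)` makes the Gelfand dual a covering map. -/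
theorem AdmitsFGProjectiveHilbertModule.isFiniteFoldCovering
    {X Y : Type*} [TopologicalSpace X] [CompactSpace X] [T2Space X]
    [TopologicalSpace Y] [CompactSpace Y] [T2Space Y]
    {i : C(X, ℂ) →⋆ₐ[ℂ] C(Y, ℂ)} (hi : Function.Injective i)
    (h : AdmitsFGProjectiveHilbertModule i) : IsFiniteFoldCovering (gelfandDual i) := by
  obtain ⟨-, -, -, hfg, hproj⟩ := h
  have hip (a : C(X, ℂ)) : a.comp (gelfandDual i) = i a :=
    ContinuousMap.ext fun y => gelfandDual_apply i a y
  -- A linear section `r` of a surjection `s` from a free module gives the dual basis.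
  obtain ⟨n, s, hs⟩ := Module.Finite.exists_fin' C(X, ℂ) (InducedModule i)
  obtain ⟨r, hr⟩ := s.exists_rightInverse_of_surjective (LinearMap.range_eq_top.2 hs)
  let u (j : Fin n) : C(Y, ℂ) := s fun k => if j = k then 1 else 0
  let φ (j : Fin n) : C(Y, ℂ) →+ C(X, ℂ) := (LinearMap.proj j ∘ₗ r).toAddMonoidHom
  have hφ (j : Fin n) (a : C(X, ℂ)) (b : C(Y, ℂ)) :
      φ j (a.comp (gelfandDual i) * b) = a * φ j b := by
    rw [hip]
    exact (LinearMap.proj j ∘ₗ r).map_smul a (b : InducedModule i)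
  have hu (b : C(Y, ℂ)) : b = ∑ j, (φ j b).comp (gelfandDual i) * u j := by
    simp only [hip]
    refine (LinearMap.congr_fun hr (b : InducedModule i)).symm.trans ?_
    exact LinearMap.pi_apply_eq_sum_univ s (r b)
  refine ⟨isCoveringMap_of_dualBasis hφ hu, surjective_of_comp_injective fun a b hab => ?_,
    finite_fiber_of_dualBasis hu⟩
  exact hi (by simpa only [hip] using hab)

theorem mainTheorem2 {X Y : Type*} [TopologicalSpace X] [CompactSpace X] [T2Space X]
    [TopologicalSpace Y] [CompactSpace Y] [T2Space Y]
    (i : C(X, ℂ) →⋆ₐ[ℂ] C(Y, ℂ)) (hi : Function.Injective i) :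
    List.TFAE [
      IsFiniteFoldCovering (gelfandDual i),
      AdmitsFGProjectiveHilbertModule i,
      ∃ E : C(Y, ℂ) →ₗ[ℂ] C(X, ℂ), IsConditionalExpectation i E ∧ IsAlgIndexFinite i E] := by
  tfae_have 1 → 3 := fun ⟨hp, hsurj, hfin⟩ =>
    have hip (a : C(X, ℂ)) (y : Y) : i a y = a (gelfandDual i y) := (gelfandDual_apply i a y).symm
    ⟨hp.fiberAverage hfin hsurj, hp.isConditionalExpectation_fiberAverage hip hfin hsurj,
      hp.isAlgIndexFinite_fiberAverage hip hfin hsurj⟩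
  tfae_have 3 → 2 := fun ⟨_, hE, hfin⟩ => hE.admitsFGProjectiveHilbertModule hfin
  tfae_have 2 → 1 := fun h => h.isFiniteFoldCovering hi
  tfae_finish
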